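/- For a probability measure $\mu$ on $\mathbb R$ with distribution function $F$, let $Q(\mu,q)=\inf\{x\in\mathbb R: F(x)\ge q\}$ be its quantile function, and let $\Phi^{-1}(q)=Q(\mathcal N(0,1),q)$ be the standard normal quantile function. For $n\in\mathbb N$ (including $n=0$) put $$C_u(x,y)=\sqrt{x(1-x)y^2n+\frac{(1-2x)^2y^4}{36}}+\frac{(1-2x)y^2}{6},\qquad C_l(x,y)=\sqrt{x(1-x)y^2n+\frac{x^2y^4}{16}}-\frac{xy^2}{4}.$$ Then for every $n\in\mathbb N$, every $p\in[0,1]$ and every $\delta$ with $0<\delta\le\frac12$, the $(1-\delta)$-quantile of the binomial distribution satisfies $$\Big\lfloor np+\max\big\{0,\min\{n(1-p),\,C_l(p,\Phi^{-1}(1-\delta))\}\big\}\Big\rfloor\;\le\; Q(\mathrm{Binom}(n,p),1-\delta)\;\le\; np+C_u(p,\Phi^{-1}(1-\delta))+1.$$ -/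

import Mathlib

open MeasureTheory ProbabilityTheory

noncomputable section

/-- The quantile function `Q(μ, q) = inf {x : F(x) ≥ q}` of a probability measure `μ` on `ℝ`
with distribution function `F`. -/
def quantile (μ : Measure ℝ) (q : ℝ) : ℝ :=
  sInf {x : ℝ | q ≤ cdf μ x}

/-- The binomial distribution with parameters `n` and `p`, as a measure on `ℝ`. -/
def binomReal (n : ℕ) (p : unitInterval) : Measure ℝ :=
  (ProbabilityTheory.binomial n p).map (Nat.cast : ℕ → ℝ)

/-- The quantile function `Φ⁻¹` of the standard normal distribution. -/
def stdNormalQuantile (q : ℝ) : ℝ :=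
  quantile (gaussianReal 0 1) q

/-- The upper correction
`C_u(x, y) = √(x (1 - x) y² n + (1 - 2 x)² y⁴ / 36) + (1 - 2 x) y² / 6`. -/
def upperCorrection (n : ℕ) (x y : ℝ) : ℝ :=
  Real.sqrt (x * (1 - x) * y ^ 2 * n + (1 - 2 * x) ^ 2 * y ^ 4 / 36) + (1 - 2 * x) * y ^ 2 / 6

/-- The lower correction `C_l(x, y) = √(x (1 - x) y² n + x² y⁴ / 16) - x y² / 4`. -/
def lowerCorrection (n : ℕ) (x y : ℝ) : ℝ :=
  Real.sqrt (x * (1 - x) * y ^ 2 * n + x ^ 2 * y ^ 4 / 16) - x * y ^ 2 / 4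

end

/-!
Write `H(x, p)` for the relative entropy of the Bernoulli law with parameter `x` with respect to the
one with parameter `p`. The quantile bounds follow from the inequality of Zubkov and Serov: for a
binomial variable `X` with parameters `N` and `p`, and for `0 ≤ k < N`, `x = k / N`,
`Φ(± √(2 N H(x, p))) < P(X ≤ k)`, with the sign of `x - p` (`cdf_signedRoot_lt_binomCdf`).
Counting failures instead of successes turns it into an upper bound for `P(X ≤ m - 1)` by
`Φ(± √(2 N H(m / N, p)))`.

To prove it, fix `k` and let `p` run through `(0, 1)`. Both sides are functions of `p` with explicit
derivatives. The derivative of `P(X ≤ k)` telescopes to a single term, and since `exp (-N H(x, p))`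
is the binomial likelihood up to a constant factor, the sign of the derivative of the difference of
the two sides is that of a constant minus `√(2 N p² H(x, p) / (p - x)²)`. The function
`p² H(x, p) / (p - x)²` is strictly increasing on `(0, 1)`, also across `p = x`
(`strictMonoOn_divRatio`). So the difference first increases and then decreases, and as its limits
at `0` and `1` are not negative, it is positive.

What remains is to compare `H` with quadratic functions. With `t = x - p > 0`,
`t² / (2 (p (1 - p) + (1 - 2 p) t / 3)) ≤ H(x, p) < t² / (2 (p (1 - p) - p t / 2))`
(`sq_le_mul_bernoulliDiv`, `bernoulliDiv_lt_sq_div`); both hold because the sides agree at `p = x`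
and their derivatives in `p` are ordered. Solving the quadratic equations that arise when either
bound, multiplied by `2 n`, is set equal to `y²` gives `n t = C_u(p, y)` and `n t = C_l(p, y)`.
-/

open Set Filter Topology

/-! ### The relative entropy of Bernoulli laws -/

theorem lt_of_hasDerivAt_pos {f f' : ℝ → ℝ} {a b : ℝ} (hab : a < b)
    (hc : ContinuousOn f (Icc a b)) (hd : ∀ s ∈ Ioo a b, HasDerivAt f (f' s) s)
    (hp : ∀ s ∈ Ioo a b, 0 < f' s) : f a < f b := by
  refine strictMonoOn_of_deriv_pos (convex_Icc a b) hc (fun s hs => ?_)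
    (left_mem_Icc.2 hab.le) (right_mem_Icc.2 hab.le) hab
  rw [interior_Icc] at hs
  rw [(hd s hs).deriv]
  exact hp s hs

/-- The relative entropy `x log (x / p) + (1 - x) log ((1 - x) / (1 - p))` of the Bernoulli law
with parameter `x` with respect to the one with parameter `p`. The logarithms of the quotients are
split, so that the convention `0 * log 0 = 0` is right at `x = 0` and at `x = 1`. -/
noncomputable def bernoulliDiv (x p : ℝ) : ℝ :=
  x * (Real.log x - Real.log p) + (1 - x) * (Real.log (1 - x) - Real.log (1 - p))

theorem bernoulliDiv_self (x : ℝ) : bernoulliDiv x x = 0 := by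
  simp [bernoulliDiv]

theorem bernoulliDiv_one_sub (x p : ℝ) : bernoulliDiv (1 - x) (1 - p) = bernoulliDiv x p := by
  simp only [bernoulliDiv, sub_sub_cancel]
  ring

theorem hasDerivAt_bernoulliDiv (x : ℝ) {p : ℝ} (h0 : 0 < p) (h1 : p < 1) :
    HasDerivAt (bernoulliDiv x) ((p - x) / (p * (1 - p))) p := by
  have hq : 0 < 1 - p := sub_pos.2 h1
  have e1 := ((Real.hasDerivAt_log h0.ne').const_sub (Real.log x)).const_mul x
  have e2 := ((((hasDerivAt_id p).const_sub 1).log hq.ne').const_sub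
    (Real.log (1 - x))).const_mul (1 - x)
  refine HasDerivAt.congr_deriv (e1.add e2) ?_
  simp only [id_eq]
  field_simp
  ring

theorem continuousOn_bernoulliDiv_Icc_right {x p : ℝ} (hx : 0 ≤ x) (hp : p < 1) :
    ContinuousOn (bernoulliDiv x) (Icc x p) := by
  have h2 : ContinuousOn (fun s : ℝ => (1 - x) * (Real.log (1 - x) - Real.log (1 - s)))
      (Icc x p) := by
    refine continuousOn_const.mul (continuousOn_const.sub (ContinuousOn.log (by fun_prop) ?_))
    intro s hs
    linarith [hs.2]
  rcases hx.eq_or_lt with rfl | hx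
  · refine h2.congr fun s _ => ?_
    simp [bernoulliDiv]
  · refine ContinuousOn.add (continuousOn_const.mul (continuousOn_const.sub
      (ContinuousOn.log continuousOn_id ?_))) h2
    intro s hs
    exact (hx.trans_le hs.1).ne'

theorem continuousOn_bernoulliDiv_Icc_left {x p : ℝ} (hx : x ≤ 1) (hp : 0 < p) :
    ContinuousOn (bernoulliDiv x) (Icc p x) := by
  have h := continuousOn_bernoulliDiv_Icc_right (x := 1 - x) (p := 1 - p) (by linarith)
    (by linarith)
  have h' := h.comp (f := fun s : ℝ => 1 - s) (s := Icc p x) (by fun_prop)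
    (fun s hs => ⟨by linarith [hs.2], by linarith [hs.1]⟩)
  refine h'.congr fun s _ => ?_
  simp [bernoulliDiv_one_sub]

theorem bernoulliDiv_pos_of_lt {x p : ℝ} (hx : 0 ≤ x) (hxp : x < p) (hp : p < 1) :
    0 < bernoulliDiv x p := by
  have h := lt_of_hasDerivAt_pos hxp (continuousOn_bernoulliDiv_Icc_right hx hp)
    (fun s hs => hasDerivAt_bernoulliDiv x (hx.trans_lt hs.1) (hs.2.trans hp))
    (fun s hs => div_pos (sub_pos.2 hs.1)
      (mul_pos (hx.trans_lt hs.1) (sub_pos.2 (hs.2.trans hp))))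
  rwa [bernoulliDiv_self] at h

theorem bernoulliDiv_pos {x p : ℝ} (hx0 : 0 ≤ x) (hx1 : x ≤ 1) (hp0 : 0 < p) (hp1 : p < 1)
    (hne : p ≠ x) : 0 < bernoulliDiv x p := by
  rcases hne.lt_or_gt with h | h
  · rw [← bernoulliDiv_one_sub]
    exact bernoulliDiv_pos_of_lt (by linarith) (by linarith) (by linarith)
  · exact bernoulliDiv_pos_of_lt hx0 h hp1

/-- `H(x, p)` is the integral of `(s - x) / (s (1 - s))` over `s` from `x` to `p`, where
`s (1 - s) ≥ x (1 - p)`. -/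
theorem two_mul_bernoulliDiv_lt_sq {x p : ℝ} (hx : 0 ≤ x) (hxp : x < p) (hp : p < 1) :
    2 * x * (1 - p) * bernoulliDiv x p < (p - x) ^ 2 := by
  have h := lt_of_hasDerivAt_pos (f := fun s => (s - x) ^ 2 - 2 * x * (1 - s) * bernoulliDiv x s)
    (f' := fun s => 2 * (s - x) ^ 2 / s + 2 * x * bernoulliDiv x s) hxp
    (ContinuousOn.sub (by fun_prop)
      (ContinuousOn.mul (by fun_prop) (continuousOn_bernoulliDiv_Icc_right hx hp)))
    (fun s hs => by
      have hs0 := hx.trans_lt hs.1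
      have hs1 := hs.2.trans hp
      have hq : 0 < 1 - s := sub_pos.2 hs1
      refine HasDerivAt.congr_deriv ((((hasDerivAt_id s).sub_const x).pow 2).sub
        ((((hasDerivAt_id s).const_sub 1).const_mul (2 * x)).mul
          (hasDerivAt_bernoulliDiv x hs0 hs1))) ?_
      simp only [id_eq]
      field_simp
      ring)
    (fun s hs => by
      have hs0 := hx.trans_lt hs.1
      have := bernoulliDiv_pos_of_lt hx hs.1 (hs.2.trans hp)
      have := sub_pos.2 hs.1
      positivity)
  simp only [bernoulliDiv_self] at h
  linarith

/-- `H(x, p)` is the integral of `(s - x) / (s (1 - s))` over `s` from `x` to `p`, where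
`s (1 - s) ≤ p (1 - x)`. -/
theorem sq_lt_two_mul_bernoulliDiv {x p : ℝ} (hx : 0 ≤ x) (hxp : x < p) (hp : p < 1) :
    (p - x) ^ 2 < 2 * (1 - x) * p * bernoulliDiv x p := by
  have h := lt_of_hasDerivAt_pos (f := fun s => 2 * (1 - x) * s * bernoulliDiv x s - (s - x) ^ 2)
    (f' := fun s => 2 * (1 - x) * bernoulliDiv x s + 2 * (s - x) ^ 2 / (1 - s)) hxp
    (ContinuousOn.sub
      (ContinuousOn.mul (by fun_prop) (continuousOn_bernoulliDiv_Icc_right hx hp)) (by fun_prop))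
    (fun s hs => by
      have hs0 := hx.trans_lt hs.1
      have hs1 := hs.2.trans hp
      have hq : 0 < 1 - s := sub_pos.2 hs1
      refine HasDerivAt.congr_deriv ((((hasDerivAt_id s).const_mul (2 * (1 - x))).mul
          (hasDerivAt_bernoulliDiv x hs0 hs1)).sub (((hasDerivAt_id s).sub_const x).pow 2)) ?_
      simp only [id_eq]
      field_simp
      ring)
    (fun s hs => by
      have hs0 := hx.trans_lt hs.1
      have hq : 0 < 1 - s := sub_pos.2 (hs.2.trans hp)
      have hx1 : 0 < 1 - x := by linarith [hs.1]
      have := bernoulliDiv_pos_of_lt hx hs.1 (hs.2.trans hp)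
      have := sub_pos.2 hs.1
      positivity)
  simp only [bernoulliDiv_self] at h
  linarith

/-- The mirror image of `sq_lt_two_mul_bernoulliDiv`, on the left of `x`. -/
theorem sq_lt_two_mul_bernoulliDiv_left {x p : ℝ} (hx : x ≤ 1) (hpx : p < x) (hp : 0 < p) :
    (p - x) ^ 2 < 2 * x * (1 - p) * bernoulliDiv x p := by
  have h := sq_lt_two_mul_bernoulliDiv (x := 1 - x) (p := 1 - p) (by linarith) (by linarith)
    (by linarith)
  rw [bernoulliDiv_one_sub] at h
  linarith

/-- The mirror image of `two_mul_bernoulliDiv_lt_sq`, on the left of `x`. -/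
theorem two_mul_bernoulliDiv_lt_sq_left {x p : ℝ} (hx : x ≤ 1) (hpx : p < x) (hp : 0 < p) :
    2 * (1 - x) * p * bernoulliDiv x p < (p - x) ^ 2 := by
  have h := two_mul_bernoulliDiv_lt_sq (x := 1 - x) (p := 1 - p) (by linarith) (by linarith)
    (by linarith)
  rw [bernoulliDiv_one_sub] at h
  linarith

/-- Bernstein's lower bound for the relative entropy. -/
theorem sq_le_mul_bernoulliDiv {x p : ℝ} (hp : 0 < p) (hpx : p < x) (hx : x < 1) :
    (x - p) ^ 2 ≤ 2 * (p * (1 - p) + (1 - 2 * p) * (x - p) / 3) * bernoulliDiv x p := by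
  -- `E s / 3` is the Bernstein denominator at `s`; the form below shows that it is positive.
  set E : ℝ → ℝ := fun s => s * (1 - s) + s * (1 - x) + x * (1 - s) with hE
  have hEpos : ∀ s, p ≤ s → s ≤ x → 0 < E s := fun s h1 h2 => by
    have a1 : 0 < s := hp.trans_le h1
    have a2 : 0 < 1 - s := by linarith
    have a3 : 0 < 1 - x := by linarith
    have a4 : 0 < x := by linarith
    simp only [hE]
    positivity
  have hE' : ∀ s, HasDerivAt E (2 - 2 * s - 2 * x) s := fun s => by
    refine HasDerivAt.congr_deriv ((((hasDerivAt_id s).mul ((hasDerivAt_id s).const_sub 1)).add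
      ((hasDerivAt_id s).mul_const (1 - x))).add
      (((hasDerivAt_id s).const_sub 1).const_mul x)) ?_
    simp only [id_eq]
    ring
  have h : AntitoneOn (fun s => bernoulliDiv x s - 3 / 2 * ((x - s) ^ 2 / E s)) (Icc p x) := by
    have hd : ∀ s ∈ Ioo p x, HasDerivAt (fun s => bernoulliDiv x s - 3 / 2 * ((x - s) ^ 2 / E s))
        (-((x - s) * ((1 - 2 * s) ^ 2 * (x - s) ^ 2 + 3 * (s * (1 - s)) * (x - s) ^ 2)
          / (s * (1 - s) * E s ^ 2))) s := fun s hs => by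
      have hs0 : 0 < s := hp.trans hs.1
      have hs1 : s < 1 := hs.2.trans hx
      have hq : 0 < 1 - s := sub_pos.2 hs1
      have hEs := hEpos s hs.1.le hs.2.le
      refine HasDerivAt.congr_deriv ((hasDerivAt_bernoulliDiv x hs0 hs1).sub
        (((((hasDerivAt_id s).const_sub x).pow 2).div (hE' s) hEs.ne').const_mul (3 / 2))) ?_
      simp only [id_eq, Pi.pow_apply]
      field_simp
      simp only [hE]
      ring
    refine antitoneOn_of_deriv_nonpos (convex_Icc p x) ?_ ?_ ?_
    · refine (continuousOn_bernoulliDiv_Icc_left hx.le hp).sub (continuousOn_const.mul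
        (ContinuousOn.div (by fun_prop) (by fun_prop) fun s hs => (hEpos s hs.1 hs.2).ne'))
    · intro s hs
      rw [interior_Icc] at hs
      exact (hd s hs).differentiableAt.differentiableWithinAt
    · intro s hs
      rw [interior_Icc] at hs
      rw [(hd s hs).deriv]
      have hs0 : 0 < s := hp.trans hs.1
      have hq : 0 < 1 - s := sub_pos.2 (hs.2.trans hx)
      have hEs := hEpos s hs.1.le hs.2.le
      have ht := sub_pos.2 hs.2
      rw [Left.neg_nonpos_iff]
      positivity
  have h' := h (left_mem_Icc.2 hpx.le) (right_mem_Icc.2 hpx.le) hpx.le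
  have hEp := hEpos p le_rfl hpx.le
  simp only [bernoulliDiv_self, sub_self] at h'
  have h2 : 3 / 2 * ((x - p) ^ 2 / E p) ≤ bernoulliDiv x p := by
    simpa using h'
  have h3 : 3 / 2 * (x - p) ^ 2 ≤ bernoulliDiv x p * E p := by
    rw [← mul_div_assoc] at h2
    exact (div_le_iff₀ hEp).1 h2
  simp only [hE] at h3
  linarith

/-- An upper bound for the relative entropy, strict off the diagonal. -/
theorem bernoulliDiv_lt_sq_div {x p : ℝ} (hp : 0 < p) (hpx : p < x) (hx : x ≤ 1) :
    bernoulliDiv x p < (x - p) ^ 2 / (p * (2 - p - x)) := by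
  rcases hx.eq_or_lt with rfl | hx
  · have h := Real.log_lt_sub_one_of_pos (inv_pos.2 hp) (by
      rw [Ne, inv_eq_one]
      exact hpx.ne)
    rw [Real.log_inv] at h
    have hq : 0 < 1 - p := sub_pos.2 hpx
    have e : (1 - p) ^ 2 / (p * (2 - p - 1)) = p⁻¹ - 1 := by
      have : 2 - p - 1 = 1 - p := by ring
      rw [this]
      field_simp
    rw [e]
    simpa [bernoulliDiv] using h
  have hpos : ∀ s, p ≤ s → s ≤ x → 0 < s * (2 - s - x) := fun s h1 h2 =>
    mul_pos (hp.trans_le h1) (by linarith)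
  have h := lt_of_hasDerivAt_pos
    (f := fun s => bernoulliDiv x s - (x - s) ^ 2 / (s * (2 - s - x)))
    (f' := fun s => (x - s) ^ 2 * ((1 - s) * (2 - s) - (x - s)) /
      (s ^ 2 * (1 - s) * (2 - s - x) ^ 2)) hpx
    ((continuousOn_bernoulliDiv_Icc_left hx.le hp).sub
      (ContinuousOn.div (by fun_prop) (by fun_prop) fun s hs => (hpos s hs.1 hs.2).ne'))
    (fun s hs => by
      have hs0 : 0 < s := hp.trans hs.1
      have hs1 : s < 1 := hs.2.trans hx
      have hq : 0 < 1 - s := sub_pos.2 hs1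
      have h2 : 0 < 2 - s - x := by linarith
      have hne := hpos s hs.1.le hs.2.le
      refine HasDerivAt.congr_deriv ((hasDerivAt_bernoulliDiv x hs0 hs1).sub
        ((((hasDerivAt_id s).const_sub x).pow 2).div
          ((hasDerivAt_id s).mul (((hasDerivAt_id s).const_sub 2).sub_const x)) hne.ne')) ?_
      simp only [id_eq, Pi.pow_apply]
      field_simp
      ring)
    (fun s hs => by
      have hs0 : 0 < s := hp.trans hs.1
      have hs1 : s < 1 := hs.2.trans hx
      have hq : 0 < 1 - s := sub_pos.2 hs1
      have h2 : 0 < 2 - s - x := by linarith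
      have h3 : 0 < (1 - s) * (2 - s) - (x - s) := by nlinarith
      have ht := sub_pos.2 hs.2
      positivity)
  simp only [bernoulliDiv_self, sub_self] at h
  have h' : bernoulliDiv x p - (x - p) ^ 2 / (p * (2 - p - x)) < 0 := by simpa using h
  linarith

/-! ### Monotonicity of the entropy ratio -/

/-- The function `p² H(x, p) / (p - x)²` of `p`, with its limit `x / (2 (1 - x))` at `p = x`. -/
noncomputable def divRatio (x p : ℝ) : ℝ :=
  if p = x then x / (2 * (1 - x)) else p ^ 2 * bernoulliDiv x p / (p - x) ^ 2

theorem hasDerivAt_divRatio {x p : ℝ} (hp0 : 0 < p) (hp1 : p < 1) (hne : p ≠ x) :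
    HasDerivAt (divRatio x)
      (p * ((p - x) ^ 2 - 2 * x * (1 - p) * bernoulliDiv x p) / ((1 - p) * (p - x) ^ 3)) p := by
  have hq : 0 < 1 - p := sub_pos.2 hp1
  have hne' : p - x ≠ 0 := sub_ne_zero.2 hne
  have h : HasDerivAt (fun p => p ^ 2 * bernoulliDiv x p / (p - x) ^ 2)
      (p * ((p - x) ^ 2 - 2 * x * (1 - p) * bernoulliDiv x p) / ((1 - p) * (p - x) ^ 3)) p := by
    refine HasDerivAt.congr_deriv ((((hasDerivAt_id p).pow 2).mul
      (hasDerivAt_bernoulliDiv x hp0 hp1)).div (((hasDerivAt_id p).sub_const x).pow 2)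
        (pow_ne_zero 2 hne')) ?_
    simp only [id_eq, Pi.mul_apply, Pi.pow_apply]
    field_simp
    ring
  refine h.congr_of_eventuallyEq ?_
  filter_upwards [isOpen_ne.mem_nhds hne] with s hs
  exact if_neg hs

theorem divRatio_lt_of_lt_of_lt {x s t : ℝ} (hx1 : x ≤ 1) (hs : 0 < s) (hst : s < t)
    (htx : t < x) : divRatio x s < divRatio x t := by
  refine lt_of_hasDerivAt_pos hst (fun u hu => (hasDerivAt_divRatio (hs.trans_le hu.1)
      (hu.2.trans_lt (htx.trans_le hx1)) (hu.2.trans_lt htx).ne).continuousAt.continuousWithinAt)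
    (fun u hu => hasDerivAt_divRatio (hs.trans hu.1) (hu.2.trans (htx.trans_le hx1))
      (hu.2.trans htx).ne) fun u hu => ?_
  have hu0 := hs.trans hu.1
  have hux := hu.2.trans htx
  have h1 := sq_lt_two_mul_bernoulliDiv_left hx1 hux hu0
  refine div_pos_of_neg_of_neg (mul_neg_of_pos_of_neg hu0 (by linarith))
    (mul_neg_of_pos_of_neg (by linarith) (Odd.pow_neg (by decide) (by linarith)))

theorem divRatio_lt_of_gt_of_lt {x s t : ℝ} (hx0 : 0 ≤ x) (hxs : x < s) (hst : s < t)
    (ht : t < 1) : divRatio x s < divRatio x t := by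
  refine lt_of_hasDerivAt_pos hst (fun u hu => (hasDerivAt_divRatio
      (hx0.trans_lt (hxs.trans_le hu.1)) (hu.2.trans_lt ht)
      (hxs.trans_le hu.1).ne').continuousAt.continuousWithinAt)
    (fun u hu => hasDerivAt_divRatio (hx0.trans_lt (hxs.trans hu.1)) (hu.2.trans ht)
      (hxs.trans hu.1).ne') fun u hu => ?_
  have hxu := hxs.trans hu.1
  have hu1 := hu.2.trans ht
  have h1 := two_mul_bernoulliDiv_lt_sq hx0 hxu hu1
  exact div_pos (mul_pos (hx0.trans_lt hxu) (by linarith))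
    (mul_pos (by linarith) (pow_pos (by linarith) 3))

theorem divRatio_lt_self {x s : ℝ} (hx1 : x < 1) (hs : 0 < s) (hsx : s < x) :
    divRatio x s < divRatio x x := by
  have h := two_mul_bernoulliDiv_lt_sq_left hx1.le hsx hs
  have hq : 0 < 1 - x := sub_pos.2 hx1
  have hd : 0 < (s - x) ^ 2 := sq_pos_of_neg (by linarith)
  rw [divRatio, divRatio, if_neg hsx.ne, if_pos rfl, div_lt_div_iff₀ hd (by positivity)]
  calc s ^ 2 * bernoulliDiv x s * (2 * (1 - x))
      = s * (2 * (1 - x) * s * bernoulliDiv x s) := by ring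
    _ < s * (s - x) ^ 2 := by gcongr
    _ < x * (s - x) ^ 2 := by gcongr

theorem self_lt_divRatio {x t : ℝ} (hx0 : 0 ≤ x) (hxt : x < t) (ht : t < 1) :
    divRatio x x < divRatio x t := by
  have h := sq_lt_two_mul_bernoulliDiv hx0 hxt ht
  have hq : 0 < 1 - x := by linarith
  have ht0 : 0 < t := hx0.trans_lt hxt
  have hd : 0 < (t - x) ^ 2 := pow_pos (by linarith) 2
  rw [divRatio, divRatio, if_pos rfl, if_neg hxt.ne', div_lt_div_iff₀ (by positivity) hd]
  calc x * (t - x) ^ 2 < t * (t - x) ^ 2 := by gcongr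
    _ < t * (2 * (1 - x) * t * bernoulliDiv x t) := by gcongr
    _ = t ^ 2 * bernoulliDiv x t * (2 * (1 - x)) := by ring

theorem strictMonoOn_divRatio {x : ℝ} (hx0 : 0 ≤ x) (hx1 : x < 1) :
    StrictMonoOn (divRatio x) (Ioo 0 1) := by
  intro s hs t ht hst
  rcases lt_trichotomy s x with h | rfl | h
  · rcases lt_trichotomy t x with h' | rfl | h'
    · exact divRatio_lt_of_lt_of_lt hx1.le hs.1 hst h'
    · exact divRatio_lt_self hx1 hs.1 hst
    · exact (divRatio_lt_self hx1 hs.1 h).trans (self_lt_divRatio hx0 h' ht.2)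
  · exact self_lt_divRatio hx0 hst ht.2
  · exact divRatio_lt_of_gt_of_lt hx0 h hst ht.2

/-! ### The standard normal distribution function -/

theorem cdf_gaussianReal_eq_integral (x : ℝ) :
    cdf (gaussianReal 0 1) x = ∫ t in Iic x, gaussianPDFReal 0 1 t := by
  rw [cdf_eq_real, measureReal_def, gaussianReal_apply_eq_integral 0 one_ne_zero,
    ENNReal.toReal_ofReal]
  exact integral_nonneg fun t => gaussianPDFReal_nonneg 0 1 t

theorem continuous_gaussianPDFReal_std : Continuous (gaussianPDFReal 0 1) := by
  rw [gaussianPDFReal_def]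
  fun_prop

theorem hasDerivAt_cdf_gaussianReal (x : ℝ) :
    HasDerivAt (cdf (gaussianReal 0 1)) (gaussianPDFReal 0 1 x) x := by
  have hi := integrable_gaussianPDFReal 0 1
  have h : (cdf (gaussianReal 0 1) : ℝ → ℝ) =
      fun x => (∫ t in Iic (0 : ℝ), gaussianPDFReal 0 1 t) +
        ∫ t in (0 : ℝ)..x, gaussianPDFReal 0 1 t := by
    funext x
    rw [cdf_gaussianReal_eq_integral,
      ← intervalIntegral.integral_Iic_sub_Iic hi.integrableOn hi.integrableOn]
    ring
  rw [h]
  exact (intervalIntegral.integral_hasDerivAt_right hi.intervalIntegrable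
    (continuous_gaussianPDFReal_std.stronglyMeasurableAtFilter _ _)
    continuous_gaussianPDFReal_std.continuousAt).const_add _

theorem continuous_cdf_gaussianReal : Continuous (cdf (gaussianReal 0 1)) :=
  continuous_iff_continuousAt.2 fun x => (hasDerivAt_cdf_gaussianReal x).continuousAt

theorem strictMono_cdf_gaussianReal : StrictMono (cdf (gaussianReal 0 1)) :=
  strictMono_of_hasDerivAt_pos hasDerivAt_cdf_gaussianReal fun x =>
    gaussianPDFReal_pos 0 1 x one_ne_zero

theorem cdf_gaussianReal_neg (x : ℝ) :
    cdf (gaussianReal 0 1) (-x) = 1 - cdf (gaussianReal 0 1) x := by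
  have := nullSingletonClass_gaussianReal (μ := 0) (v := 1) one_ne_zero
  have h1 : (gaussianReal 0 1).real (Iic (-x)) = (gaussianReal 0 1).real (Ici x) := by
    conv_lhs => rw [← neg_zero, ← gaussianReal_map_neg]
    rw [map_measureReal_apply (by fun_prop) measurableSet_Iic]
    congr 1
    ext t
    simp
  rw [cdf_eq_real, cdf_eq_real, h1, measureReal_congr Ioi_ae_eq_Ici.symm, ← compl_Iic,
    probReal_compl_eq_one_sub measurableSet_Iic]

theorem cdf_gaussianReal_zero : cdf (gaussianReal 0 1) 0 = 1 / 2 := by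
  have h := cdf_gaussianReal_neg 0
  rw [neg_zero] at h
  linarith

theorem cdf_stdNormalQuantile {q : ℝ} (h0 : 0 < q) (h1 : q < 1) :
    cdf (gaussianReal 0 1) (stdNormalQuantile q) = q := by
  obtain ⟨a, ha⟩ := ((tendsto_cdf_atBot (gaussianReal 0 1)).eventually_lt_const h0).exists
  obtain ⟨b, hb⟩ := ((tendsto_cdf_atTop (gaussianReal 0 1)).eventually_const_lt h1).exists
  obtain ⟨y, hy⟩ := mem_range_of_exists_le_of_exists_ge continuous_cdf_gaussianReal
    ⟨a, ha.le⟩ ⟨b, hb.le⟩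
  have h : {x : ℝ | q ≤ cdf (gaussianReal 0 1) x} = Ici y := by
    ext x
    rw [mem_ofPred_eq, ← hy, strictMono_cdf_gaussianReal.le_iff_le, mem_Ici]
  rw [stdNormalQuantile, quantile, h, csInf_Ici, hy]

/-! ### The binomial distribution function -/

/-- The probability that a binomial random variable with parameters `n` and `p` is at most `k`, as
a polynomial in `p`. -/
noncomputable def binomCdf (n k : ℕ) (p : ℝ) : ℝ :=
  ∑ i ∈ Finset.range (k + 1), (n.choose i : ℝ) * p ^ i * (1 - p) ^ (n - i)

theorem cdf_binomReal_natCast (n k : ℕ) (p : unitInterval) :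
    cdf (binomReal n p) k = binomCdf n k p := by
  have : IsProbabilityMeasure (binomReal n p) := isProbabilityMeasure_map_cast_binomial
  rw [cdf_eq_real, binomReal, map_measureReal_apply (by fun_prop) measurableSet_Iic]
  have h : (Nat.cast : ℕ → ℝ) ⁻¹' Iic (k : ℝ) = ↑(Finset.range (k + 1)) := by
    ext i
    simp
  rw [h, ← sum_measureReal_singleton, binomCdf]
  exact Finset.sum_congr rfl fun i _ => binomial_real_singleton n i p

theorem cdf_binomReal_of_neg (n : ℕ) (p : unitInterval) {x : ℝ} (hx : x < 0) :
    cdf (binomReal n p) x = 0 := by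
  have : IsProbabilityMeasure (binomReal n p) := isProbabilityMeasure_map_cast_binomial
  rw [cdf_eq_real, binomReal, map_measureReal_apply (by fun_prop) measurableSet_Iic]
  have h : (Nat.cast : ℕ → ℝ) ⁻¹' Iic x = ∅ := by
    ext i
    simpa using hx.trans_le i.cast_nonneg
  rw [h, measureReal_empty]

theorem cdf_binomReal_eq_floor (n : ℕ) (p : unitInterval) {x : ℝ} (hx : 0 ≤ x) :
    cdf (binomReal n p) x = cdf (binomReal n p) (⌊x⌋₊ : ℝ) := by
  have : IsProbabilityMeasure (binomReal n p) := isProbabilityMeasure_map_cast_binomial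
  rw [cdf_eq_real, cdf_eq_real, binomReal, map_measureReal_apply (by fun_prop) measurableSet_Iic,
    map_measureReal_apply (by fun_prop) measurableSet_Iic]
  congr 1
  ext i
  simp [Nat.le_floor_iff hx]

theorem binomCdf_of_le {n k : ℕ} (h : n ≤ k) (p : ℝ) : binomCdf n k p = 1 := by
  have h1 := add_pow p (1 - p) n
  rw [add_sub_cancel, one_pow] at h1
  rw [h1, binomCdf]
  symm
  refine Finset.sum_subset_zero_on_sdiff (Finset.range_mono (by omega)) (fun i hi => ?_)
    (fun i _ => by ring)
  simp only [Finset.mem_sdiff, Finset.mem_range, not_lt] at hi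
  rw [Nat.choose_eq_zero_of_lt (by omega)]
  simp

/-- Counting failures instead of successes. -/
theorem binomCdf_one_sub {n m : ℕ} (h : m < n) (p : ℝ) :
    binomCdf n m p = 1 - binomCdf n (n - 1 - m) (1 - p) := by
  have h1 := binomCdf_of_le (le_refl n) p
  rw [binomCdf] at h1
  rw [eq_sub_iff_add_eq, binomCdf, binomCdf]
  refine Eq.trans ?_ h1
  have e : n + 1 = (m + 1) + (n - 1 - m + 1) := by omega
  rw [e, Finset.sum_range_add _ (m + 1), add_right_inj, ← Finset.sum_range_reflect]
  refine Finset.sum_congr rfl fun i hi => ?_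
  have hi' := Finset.mem_range.1 hi
  have e1 : n - 1 - m + 1 - 1 - i = n - (m + 1 + i) := by omega
  have e2 : n - (n - (m + 1 + i)) = m + 1 + i := by omega
  rw [e1, e2, Nat.choose_symm (by omega), sub_sub_cancel]
  ring

/-- The derivatives of the Bernstein polynomials telescope. -/
theorem hasDerivAt_binomCdf (n k : ℕ) (p : ℝ) :
    HasDerivAt (binomCdf (n + 1) k)
      (-((n + 1) * (n.choose k : ℝ) * p ^ k * (1 - p) ^ (n - k))) p := by
  have h : binomCdf (n + 1) k = fun p => ((∑ i ∈ Finset.range (k + 1),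
      bernsteinPolynomial ℝ (n + 1) i).eval p) := by
    funext p
    rw [Polynomial.eval_finsetSum]
    simp [bernsteinPolynomial, binomCdf]
  have h' : Polynomial.derivative (∑ i ∈ Finset.range (k + 1), bernsteinPolynomial ℝ (n + 1) i) =
      -((n + 1 : ℕ) * bernsteinPolynomial ℝ n k) := by
    clear h
    induction k with
    | zero =>
      rw [Finset.sum_range_one, bernsteinPolynomial.derivative_zero]
      simp
      ring
    | succ k ih =>
      rw [Finset.sum_range_succ, Polynomial.derivative_add, ih,
        bernsteinPolynomial.derivative_succ]
      simp
      ring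
  rw [h]
  refine (Polynomial.hasDerivAt _ p).congr_deriv ?_
  rw [h']
  simp [bernsteinPolynomial]
  ring

/-! ### The inequality of Zubkov and Serov -/

/-- The signed root `± √(2 N H(x, p))` of the log-likelihood ratio, with the sign of `x - p`. -/
noncomputable def signedRoot (N x p : ℝ) : ℝ :=
  if p ≤ x then √(2 * N * bernoulliDiv x p) else -√(2 * N * bernoulliDiv x p)

theorem sq_signedRoot {N x p : ℝ} (h : 0 ≤ N * bernoulliDiv x p) :
    signedRoot N x p ^ 2 = 2 * N * bernoulliDiv x p := by
  have h' : 0 ≤ 2 * N * bernoulliDiv x p := by linarith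
  unfold signedRoot
  split_ifs
  · exact Real.sq_sqrt h'
  · rw [neg_sq, Real.sq_sqrt h']

theorem hasDerivAt_signedRoot {N x p : ℝ} (hN : 0 < N) (hx0 : 0 ≤ x) (hx1 : x ≤ 1) (hp0 : 0 < p)
    (hp1 : p < 1) (hne : p ≠ x) :
    HasDerivAt (signedRoot N x)
      (-(N * |p - x| / (p * (1 - p) * √(2 * N * bernoulliDiv x p)))) p := by
  have hH := bernoulliDiv_pos hx0 hx1 hp0 hp1 hne
  have hH' : 0 < 2 * N * bernoulliDiv x p := by positivity
  have hR := Real.sqrt_pos.2 hH'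
  have hq : 0 < 1 - p := sub_pos.2 hp1
  have hd := ((hasDerivAt_bernoulliDiv x hp0 hp1).const_mul (2 * N)).sqrt hH'.ne'
  rcases hne.lt_or_gt with h | h
  · refine (hd.congr_deriv ?_).congr_of_eventuallyEq ?_
    · rw [abs_of_neg (sub_neg.2 h)]
      field_simp
    · filter_upwards [Iio_mem_nhds h] with s hs
      exact if_pos (le_of_lt hs)
  · refine (hd.neg.congr_deriv ?_).congr_of_eventuallyEq ?_
    · rw [abs_of_pos (sub_pos.2 h)]
      field_simp
    · filter_upwards [Ioi_mem_nhds h] with s hs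
      exact if_neg (not_le.2 hs)

theorem continuousAt_signedRoot_self {N x : ℝ} (hx0 : 0 < x) (hx1 : x < 1) :
    ContinuousAt (signedRoot N x) x := by
  have h0 : signedRoot N x x = 0 := by simp [signedRoot, bernoulliDiv_self]
  rw [ContinuousAt, h0, tendsto_zero_iff_abs_tendsto_zero]
  have h1 : ContinuousAt (fun p => √(2 * N * bernoulliDiv x p)) x :=
    (continuousAt_const.mul (hasDerivAt_bernoulliDiv x hx0 hx1).continuousAt).sqrt
  rw [ContinuousAt, bernoulliDiv_self, mul_zero, Real.sqrt_zero] at h1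
  refine h1.congr fun p => ?_
  simp only [Function.comp_apply, signedRoot]
  split_ifs
  · rw [abs_of_nonneg (Real.sqrt_nonneg _)]
  · rw [abs_neg, abs_of_nonneg (Real.sqrt_nonneg _)]

theorem tendsto_signedRoot_one {N x : ℝ} (hN : 0 < N) (hx1 : x < 1) :
    Tendsto (signedRoot N x) (𝓝[<] 1) atBot := by
  have h1 : Tendsto (fun p : ℝ => x * (Real.log x - Real.log p)) (𝓝[<] 1)
      (𝓝 (x * (Real.log x - Real.log 1))) :=
    (((Real.continuousAt_log one_ne_zero).tendsto.const_sub _).const_mul x).mono_left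
      nhdsWithin_le_nhds
  have h2 : Tendsto (fun p : ℝ => 1 - p) (𝓝[<] 1) (𝓝[>] 0) := by
    refine tendsto_nhdsWithin_iff.2 ⟨?_, ?_⟩
    · have : Tendsto (fun p : ℝ => 1 - p) (𝓝 1) (𝓝 (1 - 1)) := tendsto_id.const_sub 1
      rw [sub_self] at this
      exact this.mono_left nhdsWithin_le_nhds
    · filter_upwards [self_mem_nhdsWithin] with p hp
      exact sub_pos.2 (mem_Iio.1 hp)
  have h3 : Tendsto (fun p : ℝ => (1 - x) * (Real.log (1 - x) - Real.log (1 - p))) (𝓝[<] 1)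
      atTop := by
    refine Tendsto.const_mul_atTop (sub_pos.2 hx1) ?_
    refine tendsto_atTop_add_const_left _ _ ?_
    exact tendsto_neg_atBot_atTop.comp (Real.tendsto_log_nhdsGT_zero.comp h2)
  have h4 : Tendsto (bernoulliDiv x) (𝓝[<] 1) atTop := h1.add_atTop h3
  have h5 : Tendsto (fun p => -√(2 * N * bernoulliDiv x p)) (𝓝[<] 1) atBot :=
    tendsto_neg_atTop_atBot.comp (Real.tendsto_sqrt_atTop.comp
      (h4.const_mul_atTop (by positivity)))
  refine h5.congr' ?_
  filter_upwards [nhdsWithin_le_nhds (Ioi_mem_nhds hx1)] with p hp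
  exact (if_neg (not_le.2 hp)).symm

/-- The exponential of minus the relative entropy is the binomial likelihood, up to a factor that
does not depend on `p`. -/
theorem exp_neg_mul_bernoulliDiv {n k : ℕ} (hk : k ≤ n) {x p : ℝ} (hx : (n + 1) * x = k)
    (hp0 : 0 < p) (hp1 : p < 1) :
    Real.exp (-((n + 1) * bernoulliDiv x p)) =
      p ^ k * (1 - p) ^ (n - k) * (1 - p) *
        Real.exp (-((n + 1) * (x * Real.log x + (1 - x) * Real.log (1 - x)))) := by
  have hq : 0 < 1 - p := sub_pos.2 hp1
  rw [mul_assoc (p ^ k), ← pow_succ, ← Real.exp_log (pow_pos hp0 k),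
    ← Real.exp_log (pow_pos hq (n - k + 1)), ← Real.exp_add, ← Real.exp_add, Real.log_pow,
    Real.log_pow, bernoulliDiv]
  congr 1
  have : ((n - k + 1 : ℕ) : ℝ) = n - k + 1 := by push_cast [Nat.cast_sub hk]; ring
  rw [this, ← hx]
  ring

/-- The derivative in `p` of the error of the normal approximation. Its sign is decided by
comparing `√(2 (n + 1) divRatio x p)`, which increases with `p`, to a constant. -/
theorem hasDerivAt_binomCdf_sub_cdf {n k : ℕ} (hk : k ≤ n) {x : ℝ} (hx : (n + 1) * x = k) :
    ∃ r : ℝ, ∀ p : ℝ, 0 < p → p < 1 → p ≠ x → ∃ w : ℝ, 0 < w ∧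
      HasDerivAt (fun p => binomCdf (n + 1) k p - cdf (gaussianReal 0 1) (signedRoot (n + 1) x p))
        (w * (r / √(2 * (n + 1) * divRatio x p) - 1)) p := by
  have hn : (0 : ℝ) < n + 1 := by positivity
  have hC : (0 : ℝ) < n.choose k := by exact_mod_cast Nat.choose_pos hk
  have hkn : (k : ℝ) ≤ n := by exact_mod_cast hk
  have hx0 : 0 ≤ x := by
    have : (0 : ℝ) ≤ k := k.cast_nonneg
    exact nonneg_of_mul_nonneg_right (hx ▸ this) hn
  have hx1 : x < 1 := by
    by_contra! h
    nlinarith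
  set m := Real.exp (-((n + 1) * (x * Real.log x + (1 - x) * Real.log (1 - x)))) with hm
  refine ⟨m / (√(2 * Real.pi) * n.choose k), fun p hp0 hp1 hne => ?_⟩
  have hq : 0 < 1 - p := sub_pos.2 hp1
  refine ⟨(n + 1) * n.choose k * p ^ k * (1 - p) ^ (n - k), by positivity, ?_⟩
  have hH := bernoulliDiv_pos hx0 hx1.le hp0 hp1 hne
  have hA : 0 < |p - x| := abs_pos.2 (sub_ne_zero.2 hne)
  have hR : 0 < √(2 * (n + 1) * bernoulliDiv x p) := Real.sqrt_pos.2 (by positivity)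
  refine ((hasDerivAt_binomCdf n k p).sub ((hasDerivAt_cdf_gaussianReal _).comp p
    (hasDerivAt_signedRoot hn hx0 hx1.le hp0 hp1 hne))).congr_deriv ?_
  have e1 : √(2 * (n + 1) * divRatio x p) =
      p * √(2 * (n + 1) * bernoulliDiv x p) / |p - x| := by
    rw [divRatio, if_neg hne, ← sq_abs (p - x)]
    rw [show 2 * ((n : ℝ) + 1) * (p ^ 2 * bernoulliDiv x p / |p - x| ^ 2) =
      (p / |p - x|) ^ 2 * (2 * (n + 1) * bernoulliDiv x p) by ring,
      Real.sqrt_mul (by positivity), Real.sqrt_sq (by positivity)]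
    ring
  have e2 : gaussianPDFReal 0 1 (signedRoot (n + 1) x p) =
      p ^ k * (1 - p) ^ (n - k) * (1 - p) * m / √(2 * Real.pi) := by
    rw [gaussianPDFReal, sub_zero, sq_signedRoot (by positivity), hm,
      ← exp_neg_mul_bernoulliDiv hk hx hp0 hp1]
    simp only [NNReal.coe_one, mul_one]
    rw [show -(2 * ((n : ℝ) + 1) * bernoulliDiv x p) / 2 = -((n + 1) * bernoulliDiv x p) by ring,
      div_eq_inv_mul]
  rw [e1, e2]
  have hpi : 0 < √(2 * Real.pi) := Real.sqrt_pos.2 (by positivity)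
  field_simp
  ring

/-- A version of `lt_of_hasDerivAt_pos` in which the derivative may be undefined at one point. -/
theorem lt_of_hasDerivAt_pos_of_ne {f f' : ℝ → ℝ} {a b x : ℝ} (hab : a < b)
    (hc : ContinuousOn f (Icc a b)) (hd : ∀ s ∈ Ioo a b, s ≠ x → HasDerivAt f (f' s) s)
    (hp : ∀ s ∈ Ioo a b, s ≠ x → 0 < f' s) : f a < f b := by
  by_cases hx : x ∈ Ioo a b
  · refine (lt_of_hasDerivAt_pos (f' := f') hx.1 (hc.mono (Icc_subset_Icc_right hx.2.le))
      (fun s hs => ?_) fun s hs => ?_).trans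
      (lt_of_hasDerivAt_pos (f' := f') hx.2 (hc.mono (Icc_subset_Icc_left hx.1.le))
        (fun s hs => ?_) fun s hs => ?_)
    · exact hd s ⟨hs.1, hs.2.trans hx.2⟩ hs.2.ne
    · exact hp s ⟨hs.1, hs.2.trans hx.2⟩ hs.2.ne
    · exact hd s ⟨hx.1.trans hs.1, hs.2⟩ hs.1.ne'
    · exact hp s ⟨hx.1.trans hs.1, hs.2⟩ hs.1.ne'
  · have hne : ∀ s ∈ Ioo a b, s ≠ x := fun s hs h => hx (h ▸ hs)
    exact lt_of_hasDerivAt_pos hab hc (fun s hs => hd s hs (hne s hs))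
      fun s hs => hp s hs (hne s hs)

theorem binomCdf_zero_right (n k : ℕ) : binomCdf n k 0 = 1 := by
  rw [binomCdf, Finset.sum_range_succ']
  simp

/-- The inequality of Zubkov and Serov, for `n + 1` trials: the normal approximation with the signed
root of the log-likelihood ratio is below the binomial distribution function. -/
theorem cdf_signedRoot_lt_binomCdf {n k : ℕ} (hk : k ≤ n) {x p : ℝ} (hx : (n + 1) * x = k)
    (hp0 : 0 < p) (hp1 : p < 1) :
    cdf (gaussianReal 0 1) (signedRoot (n + 1) x p) < binomCdf (n + 1) k p := by
  have hn : (0 : ℝ) < n + 1 := by positivity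
  have hkn : (k : ℝ) ≤ n := by exact_mod_cast hk
  have hx0 : 0 ≤ x := by
    have : (0 : ℝ) ≤ k := k.cast_nonneg
    exact nonneg_of_mul_nonneg_right (hx ▸ this) hn
  have hx1 : x < 1 := by
    by_contra! h
    nlinarith
  obtain ⟨r, hr⟩ := hasDerivAt_binomCdf_sub_cdf hk hx
  choose! w hw hd using hr
  set E : ℝ → ℝ := fun p =>
    binomCdf (n + 1) k p - cdf (gaussianReal 0 1) (signedRoot (n + 1) x p) with hE
  have hcF : Continuous (binomCdf (n + 1) k) :=
    continuous_iff_continuousAt.2 fun s => (hasDerivAt_binomCdf n k s).continuousAt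
  have hc : ∀ s, 0 < s → s < 1 → ContinuousAt E s := fun s h0 h1 => by
    rcases eq_or_ne s x with rfl | hne
    · exact hcF.continuousAt.sub (continuous_cdf_gaussianReal.continuousAt.comp
        (continuousAt_signedRoot_self h0 h1))
    · exact (hd s h0 h1 hne).continuousAt
  have hratio : ∀ s, 0 < s → s < 1 → s ≠ x → 0 < divRatio x s := fun s h0 h1 hne => by
    have := bernoulliDiv_pos hx0 hx1.le h0 h1 hne
    have := sub_ne_zero.2 hne
    rw [divRatio, if_neg hne]
    positivity
  have hmono : ∀ s t, 0 < s → s < t → t < 1 →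
      √(2 * (n + 1) * divRatio x s) < √(2 * (n + 1) * divRatio x t) := fun s t h0 hst h1 => by
    have hlt := strictMonoOn_divRatio hx0 hx1 ⟨h0, hst.trans h1⟩ ⟨h0.trans hst, h1⟩ hst
    have hs : 0 ≤ divRatio x s := by
      rcases eq_or_ne s x with rfl | hne
      · rw [divRatio, if_pos rfl]
        exact div_nonneg hx0 (by linarith)
      · exact (hratio s h0 (hst.trans h1) hne).le
    exact Real.sqrt_lt_sqrt (by positivity) (by gcongr)
  rw [← sub_pos]
  change 0 < E p
  rcases le_or_gt (√(2 * (n + 1) * divRatio x p)) r with hle | hgt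
  -- On the left of `p` the error increases, from a limit at `0` that is not negative.
  · have hinc : ∀ a b, 0 < a → a < b → b ≤ p → E a < E b := fun a b ha hab hb => by
      refine lt_of_hasDerivAt_pos_of_ne hab (fun s hs => (hc s (ha.trans_le hs.1)
        ((hs.2.trans hb).trans_lt hp1)).continuousWithinAt)
        (fun s hs hne => hd s (ha.trans hs.1) ((hs.2.trans_le hb).trans hp1) hne)
        fun s hs hne => ?_
      have h0 := ha.trans hs.1
      have h1 := (hs.2.trans_le hb).trans hp1
      have hpos : 0 < √(2 * (n + 1) * divRatio x s) := by
        have := hratio s h0 h1 hne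
        exact Real.sqrt_pos.2 (by positivity)
      have hlt := (hmono s p h0 (hs.2.trans_le hb) hp1).trans_le hle
      exact mul_pos (hw s h0 h1 hne) (sub_pos.2 ((one_lt_div hpos).2 hlt))
    refine lt_of_le_of_lt ?_ (hinc (p / 2) p (by linarith) (by linarith) le_rfl)
    have hlim : Tendsto (fun s => binomCdf (n + 1) k s - 1) (𝓝[>] 0) (𝓝 0) := by
      have := (hcF.tendsto 0).sub_const 1
      rw [binomCdf_zero_right, sub_self] at this
      exact this.mono_left nhdsWithin_le_nhds
    refine le_of_tendsto hlim ?_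
    filter_upwards [Ioo_mem_nhdsGT (show (0 : ℝ) < p / 2 by linarith)] with s hs
    refine le_trans ?_ (hinc s (p / 2) hs.1 hs.2 (by linarith)).le
    exact sub_le_sub_left (cdf_le_one _ _) _
  -- On the right of `p` the error decreases, to a limit at `1` that is not negative.
  · have hdec : ∀ a b, p ≤ a → a < b → b < 1 → E b < E a := fun a b ha hab hb => by
      refine neg_lt_neg_iff.1 (lt_of_hasDerivAt_pos_of_ne (f := -E) hab
        (fun s hs => (hc s (hp0.trans_le (ha.trans hs.1))
          (hs.2.trans_lt hb)).neg.continuousWithinAt)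
        (fun s hs hne => (hd s (hp0.trans (ha.trans_lt hs.1)) (hs.2.trans hb) hne).neg)
        fun s hs hne => ?_)
      have h0 := hp0.trans (ha.trans_lt hs.1)
      have h1 := hs.2.trans hb
      have hpos : 0 < √(2 * (n + 1) * divRatio x s) := by
        have := hratio s h0 h1 hne
        exact Real.sqrt_pos.2 (by positivity)
      have hlt := hgt.trans (hmono p s hp0 (ha.trans_lt hs.1) h1)
      exact neg_pos.2 (mul_neg_of_pos_of_neg (hw s h0 h1 hne)
        (sub_neg.2 ((div_lt_one hpos).2 hlt)))
    refine lt_of_le_of_lt ?_ (hdec p ((p + 1) / 2) le_rfl (by linarith) (by linarith))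
    have hlim : Tendsto (fun s => -cdf (gaussianReal 0 1) (signedRoot (n + 1) x s)) (𝓝[<] 1)
        (𝓝 0) := by
      have := ((tendsto_cdf_atBot (gaussianReal 0 1)).comp (tendsto_signedRoot_one hn hx1)).neg
      rwa [neg_zero] at this
    refine le_of_tendsto hlim ?_
    filter_upwards [Ioo_mem_nhdsLT (show (p + 1) / 2 < (1 : ℝ) by linarith)] with s hs
    refine le_trans ?_ (hdec ((p + 1) / 2) s (by linarith) hs.1 hs.2).le
    have : 0 ≤ binomCdf (n + 1) k s := by
      refine Finset.sum_nonneg fun i _ => ?_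
      have h0 : 0 ≤ s := by linarith [hs.1]
      have h1 : 0 ≤ 1 - s := by linarith [hs.2]
      positivity
    simp only [hE]
    linarith

/-! ### Quantiles of the binomial distribution -/

theorem nonneg_of_le_cdf_binomReal {n : ℕ} {p : unitInterval} {q x : ℝ} (hq : 0 < q)
    (hx : q ≤ cdf (binomReal n p) x) : 0 ≤ x := by
  by_contra! h
  rw [cdf_binomReal_of_neg n p h] at hx
  exact hq.not_ge hx

theorem quantile_binomReal_le {n k : ℕ} {p : unitInterval} {q : ℝ} (hq : 0 < q)
    (h : q ≤ binomCdf n k p) : quantile (binomReal n p) q ≤ k := by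
  refine csInf_le ⟨0, fun x hx => nonneg_of_le_cdf_binomReal hq hx⟩ ?_
  rw [mem_ofPred_eq, cdf_binomReal_natCast]
  exact h

theorem le_quantile_binomReal {n m : ℕ} {p : unitInterval} {q : ℝ} (hq0 : 0 < q) (hq1 : q ≤ 1)
    (h : 0 < m → binomCdf n (m - 1) p < q) : (m : ℝ) ≤ quantile (binomReal n p) q := by
  refine le_csInf ⟨n, ?_⟩ fun x hx => ?_
  · rwa [mem_ofPred_eq, cdf_binomReal_natCast, binomCdf_of_le le_rfl]
  · have hx0 := nonneg_of_le_cdf_binomReal hq0 hx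
    by_contra! hlt
    have hfl : ⌊x⌋₊ < m := (Nat.floor_lt hx0).2 hlt
    have hm : 0 < m := by omega
    have h1 : cdf (binomReal n p) x ≤ binomCdf n (m - 1) p := by
      rw [cdf_binomReal_eq_floor n p hx0, ← cdf_binomReal_natCast]
      exact monotone_cdf _ (by exact_mod_cast Nat.le_sub_one_of_lt hfl)
    exact (h1.trans_lt (h hm)).not_ge hx

theorem upperCorrection_nonneg (n : ℕ) {x : ℝ} (hx0 : 0 ≤ x) (hx1 : x ≤ 1) (y : ℝ) :
    0 ≤ upperCorrection n x y := by
  have hq : 0 ≤ 1 - x := sub_nonneg.2 hx1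
  have h : |(1 - 2 * x) * y ^ 2 / 6| ≤
      √(x * (1 - x) * y ^ 2 * n + (1 - 2 * x) ^ 2 * y ^ 4 / 36) := by
    refine Real.abs_le_sqrt ?_
    have : 0 ≤ x * (1 - x) * y ^ 2 * n := by positivity
    linarith
  rw [upperCorrection]
  linarith [neg_abs_le ((1 - 2 * x) * y ^ 2 / 6)]

/-- The upper correction is the root of the quadratic equation that results from replacing the
relative entropy by Bernstein's lower bound. -/
theorem sq_le_two_mul_bernoulliDiv_of_upperCorrection_le {n : ℕ} (hn : 0 < n) {p x y : ℝ}
    (hp : 0 < p) (hpx : p < x) (hx : x < 1) (h : upperCorrection n p y ≤ n * (x - p)) :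
    y ^ 2 ≤ 2 * n * bernoulliDiv x p := by
  have hn' : (0 : ℝ) < n := by exact_mod_cast hn
  set D := p * (1 - p) + (1 - 2 * p) * (x - p) / 3 with hD
  have hDpos : 0 < D := by
    have h1 : 0 < p * (1 - p) := mul_pos hp (by linarith)
    have h2 : 0 < p * (1 - x) := mul_pos hp (by linarith)
    have h3 : 0 < x * (1 - p) := mul_pos (by linarith) (by linarith)
    rw [hD]
    linarith
  have h1 := sq_le_mul_bernoulliDiv hp hpx hx
  rw [upperCorrection, ← le_sub_iff_add_le, Real.sqrt_le_iff] at h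
  have h2 : y ^ 2 * D ≤ n * (x - p) ^ 2 := by
    have h3 : n * (y ^ 2 * D) ≤ n * (n * (x - p) ^ 2) := by
      rw [hD]
      linarith [h.2]
    exact le_of_mul_le_mul_left h3 hn'
  rw [← hD] at h1
  have h3 : D * y ^ 2 ≤ D * (2 * n * bernoulliDiv x p) := by
    have := mul_le_mul_of_nonneg_left h1 hn'.le
    linarith
  exact le_of_mul_le_mul_left h3 hDpos

/-- The lower correction is the root of the quadratic equation that results from replacing the
relative entropy by its upper bound. -/
theorem two_mul_bernoulliDiv_le_sq_of_le_lowerCorrection {n : ℕ} (hn : 0 < n) {p x y : ℝ}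
    (hp : 0 < p) (hpx : p < x) (hx : x ≤ 1) (h : n * (x - p) ≤ lowerCorrection n p y) :
    2 * n * bernoulliDiv x p ≤ y ^ 2 := by
  have hn' : (0 : ℝ) < n := by exact_mod_cast hn
  have hD : 0 < p * (2 - p - x) := mul_pos hp (by linarith)
  have hq : 0 < 1 - p := by linarith
  have ht : 0 < x - p := by linarith
  have h1 := (lt_div_iff₀ hD).1 (bernoulliDiv_lt_sq_div hp hpx hx)
  rw [lowerCorrection, le_sub_iff_add_le, Real.le_sqrt' (by positivity)] at h
  have h2 : n * (2 * n * (x - p) ^ 2) ≤ n * (y ^ 2 * (p * (2 - p - x))) := by linarith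
  have h3 := le_of_mul_le_mul_left h2 hn'
  have h4 : 2 * n * bernoulliDiv x p * (p * (2 - p - x)) ≤ y ^ 2 * (p * (2 - p - x)) := by
    have := mul_le_mul_of_nonneg_left h1.le hn'.le
    linarith
  exact le_of_mul_le_mul_right h4 hD

/-- If `k` exceeds the mean by more than the upper correction, then `k` is not below the quantile. -/
theorem le_binomCdf_of_upperCorrection {n k : ℕ} {p y : ℝ} (hp0 : 0 ≤ p) (hp1 : p ≤ 1)
    (h : n * p + upperCorrection n p y < k) :
    cdf (gaussianReal 0 1) y ≤ binomCdf n k p := by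
  rcases le_or_gt n k with hnk | hkn
  · rw [binomCdf_of_le hnk]
    exact cdf_le_one _ _
  have hu := upperCorrection_nonneg n hp0 hp1 y
  have hkn' : (k : ℝ) < n := by exact_mod_cast hkn
  rcases hp0.eq_or_lt with rfl | hp0
  · rw [binomCdf_zero_right]
    exact cdf_le_one _ _
  have hn : (0 : ℝ) < n := (Nat.cast_nonneg k).trans_lt hkn'
  have hpx : p < k / n := by
    rw [lt_div_iff₀ hn]
    linarith
  have hx : (k : ℝ) / n < 1 := (div_lt_one hn).2 hkn'
  have hmul : n * ((k : ℝ) / n) = k := mul_div_cancel₀ _ hn.ne'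
  have hy := sq_le_two_mul_bernoulliDiv_of_upperCorrection_le (n := n) (y := y) (by omega) hp0
    hpx hx (by rw [mul_sub, hmul]; linarith)
  obtain ⟨N, rfl⟩ : ∃ N, n = N + 1 := ⟨n - 1, by omega⟩
  push_cast at hy hpx hmul hn hx
  have hzs := cdf_signedRoot_lt_binomCdf (n := N) (by omega) hmul hp0 (hpx.trans hx)
  refine (monotone_cdf _ ?_).trans hzs.le
  rw [signedRoot, if_pos hpx.le]
  exact Real.le_sqrt_of_sq_le hy

/-- If `m` does not exceed the mean by more than the lower correction, then `m - 1` lies below the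
quantile. -/
theorem binomCdf_pred_lt_of_lowerCorrection {n m : ℕ} {p y : ℝ} (hp0 : 0 < p) (hp1 : p < 1)
    (hm0 : 0 < m) (hmn : m ≤ n) (hy : 0 ≤ y)
    (h : n * p < m → m ≤ n * p + lowerCorrection n p y) :
    binomCdf n (m - 1) p < cdf (gaussianReal 0 1) y := by
  have hn0 : 0 < n := by omega
  have hn : (0 : ℝ) < n := by exact_mod_cast hn0
  have hmul : n * ((m : ℝ) / n) = m := mul_div_cancel₀ _ hn.ne'
  have hroot : -signedRoot n (1 - m / n) (1 - p) ≤ y := by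
    rw [signedRoot]
    split_ifs with hc
    · exact (neg_nonpos.2 (Real.sqrt_nonneg _)).trans hy
    · rw [neg_neg, bernoulliDiv_one_sub]
      have hpx : p < m / n := by linarith
      refine (Real.sqrt_le_left hy).2 (two_mul_bernoulliDiv_le_sq_of_le_lowerCorrection hn0 hp0 hpx
        ((div_le_one hn).2 (by exact_mod_cast hmn)) ?_)
      rw [mul_sub, hmul, sub_le_iff_le_add']
      refine h ?_
      rw [← hmul]
      gcongr
  obtain ⟨N, rfl⟩ : ∃ N, n = N + 1 := ⟨n - 1, by omega⟩
  have hzs := cdf_signedRoot_lt_binomCdf (n := N) (k := N + 1 - m) (x := 1 - m / (N + 1 : ℕ))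
    (p := 1 - p) (by omega)
    (by rw [Nat.cast_sub hmn, mul_sub, ← Nat.cast_add_one, hmul, mul_one]) (by linarith)
    (by linarith)
  rw [binomCdf_one_sub (by omega), show N + 1 - 1 - (m - 1) = N + 1 - m by omega]
  refine lt_of_lt_of_le (sub_lt_sub_left hzs 1) ?_
  rw [← cdf_gaussianReal_neg, ← Nat.cast_add_one]
  exact monotone_cdf _ hroot

theorem mainTheorem3 (n : ℕ) (p : unitInterval) (δ : ℝ) (hδ₀ : 0 < δ) (hδ : δ ≤ 1 / 2) :
    (⌊(n : ℝ) * (p : ℝ) +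
        max 0 (min ((n : ℝ) * (1 - (p : ℝ)))
          (lowerCorrection n (p : ℝ) (stdNormalQuantile (1 - δ))))⌋ : ℝ)
      ≤ quantile (binomReal n p) (1 - δ) ∧
    quantile (binomReal n p) (1 - δ)
      ≤ (n : ℝ) * (p : ℝ) + upperCorrection n (p : ℝ) (stdNormalQuantile (1 - δ)) + 1 := by
  have hp0 : (0 : ℝ) ≤ p := p.2.1
  have hp1 : (p : ℝ) ≤ 1 := p.2.2
  have hnp : 0 ≤ (n : ℝ) * p := by positivity
  have hΦ : cdf (gaussianReal 0 1) (stdNormalQuantile (1 - δ)) = 1 - δ :=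
    cdf_stdNormalQuantile (by linarith) (by linarith)
  have hy : 0 ≤ stdNormalQuantile (1 - δ) := by
    rw [← strictMono_cdf_gaussianReal.le_iff_le, hΦ, cdf_gaussianReal_zero]
    linarith
  set y := stdNormalQuantile (1 - δ)
  constructor
  · set c := lowerCorrection n (p : ℝ) y with hc
    set a := (n : ℝ) * p + max 0 (min ((n : ℝ) * (1 - p)) c) with ha
    have ha0 : 0 ≤ a := add_nonneg hnp (le_max_left _ _)
    rw [← natCast_floor_eq_intCast_floor ha0]
    have hma : (⌊a⌋₊ : ℝ) ≤ a := Nat.floor_le ha0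
    have hmn : ⌊a⌋₊ ≤ n := by
      refine Nat.floor_le_of_le ?_
      have : max 0 (min ((n : ℝ) * (1 - p)) c) ≤ n * (1 - p) :=
        max_le (mul_nonneg n.cast_nonneg (by linarith)) (min_le_left _ _)
      rw [ha]
      linarith
    refine le_quantile_binomReal (by linarith) (by linarith) fun hm => ?_
    rcases hp0.eq_or_lt with h0 | hp0
    · exfalso
      have hc0 : c = 0 := by simp [hc, lowerCorrection, ← h0]
      have : a = 0 := by rw [ha, hc0, ← h0]; simp
      rw [this, Nat.floor_zero] at hm
      exact hm.false
    rcases hp1.eq_or_lt with h1 | hp1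
    · rw [binomCdf_one_sub (by omega), h1, sub_self, binomCdf_zero_right]
      linarith
    rw [← hΦ]
    refine binomCdf_pred_lt_of_lowerCorrection hp0 hp1 hm hmn hy fun hlt => ?_
    -- As `⌊a⌋₊` exceeds the mean, the maximum is positive and hence equal to the minimum.
    have hpos : 0 < max 0 (min ((n : ℝ) * (1 - p)) c) := by linarith
    have : max 0 (min ((n : ℝ) * (1 - p)) c) ≤ c := by
      rcases lt_max_iff.1 hpos with h | h
      · exact absurd h (lt_irrefl 0)
      · rw [max_eq_right h.le]
        exact min_le_right _ _
    linarith
  · have hu := upperCorrection_nonneg n hp0 hp1 y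
    have hk := Nat.lt_floor_add_one ((n : ℝ) * p + upperCorrection n p y)
    refine (quantile_binomReal_le (k := ⌊(n : ℝ) * p + upperCorrection n p y⌋₊ + 1)
      (by linarith) ?_).trans ?_
    · rw [← hΦ]
      exact le_binomCdf_of_upperCorrection hp0 hp1 (by exact_mod_cast hk)
    · push_cast
      gcongr
      exact Nat.floor_le (add_nonneg hnp hu)
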